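/- Let $n\ge 2$. Let $\Delta^n=\{x\in[0,1]^n:\sum_i x_i=1\}$ be the set of classical states, with pure states $e_1,\dots,e_n$ (the standard basis vectors), ordered by the Bayesian order, which is defined recursively: for $x,y\in\Delta^2$, $$x\sqsubseteq y\iff (y_1\le x_1\le \tfrac12)\ \text{or}\ (\tfrac12\le x_1\le y_1),$$ and for $x,y\in\Delta^{m+1}$ with $m\ge 2$, $x\sqsubseteq y$ iff $p_i(x)\sqsubseteq p_i(y)$ for every $i$ with $x\neq e_i\neq y$, where $p_i(x)=\frac1{1-x_i}(x_1,\dots,\widehat{x_i},\dots,x_{m+1})\in\Delta^m$. Let $\mathcal H$ be an $n$-dimensional complex Hilbert space and let $\Omega^n$ be the set of density operators on $\mathcal H$ (self-adjoint positive linear operators of trace $1$), ordered by the spectral order: $\rho\sqsubseteq\sigma$ iff there is a self-adjoint operator $e$ on $\mathcal H$ with spectrum $\{1,\dots,n\}$ such that $\rho e=e\rho$, $\sigma e=e\sigma$ and $\mathrm{spec}(\rho|e)\sqsubseteq\mathrm{spec}(\sigma|e)$ in $\Delta^n$, where $\mathrm{spec}(\rho|e)_i=\mathrm{tr}(p_e^i\rho)$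 and $p_e^i$ is the orthogonal projection onto the eigenspace of $e$ for the eigenvalue $i$. A directed set is a nonempty subset in which any two elements have an upper bound belonging to the subset. A dcpo is a partially ordered set in which every directed subset has a supremum. In a dcpo $D$ write $x\ll y$ if for every directed $S\subseteq D$ with $\bigsqcup S=y$ there is $s\in S$ with $x\sqsubseteq s$. The dcpo $D$ is exact if for every $x\in D$ the set $\{y\in D:y\ll x\}$ of approximations of $x$ is directed and has supremum $x$. Theorem. $(\Delta^n,\sqsubseteq)$ and $(\Omega^n,\sqsubseteq)$ are exact dcpos. Moreover, let $D$ be either of them and let $\bot=(1/n,\dots,1/n)$ for $D=\Delta^n$ and $\bot=I/n$ for $D=\Omega^n$. Then $\bot$ is the least element of $D$, and for every $x\in D$ the straight line path $$\pi_{\bot x}:[0,1]\to D,\qquad \pi_{\bot x}(t)=(1-t)\bot+tx,$$ is Scott continuous (it is monotone and preserves suprema of directed sets), and $\pi_{\bot x}(t)\ll x$ for all $t<1$. -/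

import Mathlib

/-! ### Order theory

The notions below are stated for a type with a relation `≤`; that this relation is a partial order
is part of `IsDcpo`. -/

/-- A directed subset: nonempty, and any two members have an upper bound in the subset. -/
def IsDirectedSet {D : Type*} [LE D] (S : Set D) : Prop :=
  S.Nonempty ∧ DirectedOn (· ≤ ·) S

/-- A directed-complete partial order. -/
structure IsDcpo (D : Type*) [LE D] : Prop where
  isPartialOrder : IsPartialOrder D (· ≤ ·)
  exists_isLUB : ∀ S : Set D, IsDirectedSet S → ∃ a, IsLUB S a

/-- `x` approximates `y`: whenever `y` is *equal to* the supremum of a directed set `S`, some member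
of `S` is above `x`. -/
def Approximates {D : Type*} [LE D] (x y : D) : Prop :=
  ∀ S : Set D, IsDirectedSet S → IsLUB S y → ∃ s ∈ S, x ≤ s

/-- The set of approximations of `x`. -/
def approximations {D : Type*} [LE D] (x : D) : Set D :=
  {y | Approximates y x}

/-- An exact dcpo: the approximations of each element are directed, with that element as
supremum. -/
structure IsExactDcpo (D : Type*) [LE D] : Prop where
  isDcpo : IsDcpo D
  isDirectedSet_approximations : ∀ x : D, IsDirectedSet (approximations x)
  isLUB_approximations : ∀ x : D, IsLUB (approximations x) x

/-- Scott continuity: monotone, and preserving those directed suprema that exist. -/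
def IsScottContinuous {P Q : Type*} [LE P] [LE Q] (f : P → Q) : Prop :=
  (∀ a b, a ≤ b → f a ≤ f b) ∧
    ∀ (S : Set P) (a : P), IsDirectedSet S → IsLUB S a → IsLUB (f '' S) (f a)

/-! ### Classical states -/

/-- The classical states `Δⁿ`: probability vectors with `n` entries. -/
@[ext]
structure ClassicalState (n : ℕ) where
  prob : Fin n → ℝ
  mem : prob ∈ stdSimplex ℝ (Fin n)

namespace ClassicalState

/-- The pure state `eᵢ`. -/
noncomputable def pureState {n : ℕ} (i : Fin n) : ClassicalState n where
  prob := Pi.single i 1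
  mem := single_mem_stdSimplex ℝ i

theorem le_one {n : ℕ} (x : ClassicalState n) (i : Fin n) : x.prob i ≤ 1 := by
  rw [← x.mem.2]
  exact Finset.single_le_sum (fun j _ => x.mem.1 j) (Finset.mem_univ i)

theorem sum_succAbove {n : ℕ} (x : ClassicalState (n + 1)) (i : Fin (n + 1)) :
    ∑ j, x.prob (i.succAbove j) = 1 - x.prob i := by
  have h := x.mem.2
  rw [Fin.sum_univ_succAbove _ i] at h
  linarith

theorem lt_one_of_ne_pureState {n : ℕ} {x : ClassicalState (n + 1)} {i : Fin (n + 1)}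
    (h : x ≠ pureState i) : x.prob i < 1 := by
  refine lt_of_le_of_ne (x.le_one i) fun h1 => h ?_
  have h0 : ∀ j, x.prob (i.succAbove j) = 0 := by
    have hs := x.sum_succAbove i
    rw [h1, sub_self, Finset.sum_eq_zero_iff_of_nonneg (fun j _ => x.mem.1 _)] at hs
    exact fun j => hs j (Finset.mem_univ j)
  ext j
  rcases Fin.eq_self_or_eq_succAbove i j with rfl | ⟨k, rfl⟩
  · simp [pureState, h1]
  · simp [pureState, h0]

/-- The Bayesian projection `pᵢ`, defined on `Δⁿ⁺¹ \ {eᵢ}`: remove the `i`-th entry, then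
renormalize. -/
noncomputable def bayesProj {n : ℕ} (i : Fin (n + 1)) (x : ClassicalState (n + 1))
    (h : x ≠ pureState i) : ClassicalState n where
  prob := fun j => x.prob (i.succAbove j) / (1 - x.prob i)
  mem := by
    have h1 : 0 < 1 - x.prob i := sub_pos.2 (lt_one_of_ne_pureState h)
    refine ⟨fun j => div_nonneg (x.mem.1 _) h1.le, ?_⟩
    rw [← Finset.sum_div, sum_succAbove, div_self h1.ne']

/-- The Bayesian order on `Δⁿ` for `n ≥ 2`, by recursion on `n` (the values for `n < 2`, where
there is at most one state, are conventional). -/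
def BayesLE : (n : ℕ) → ClassicalState n → ClassicalState n → Prop
  | 0, _, _ => True
  | 1, _, _ => True
  | 2, x, y =>
      (y.prob 0 ≤ x.prob 0 ∧ x.prob 0 ≤ 1 / 2) ∨ (1 / 2 ≤ x.prob 0 ∧ x.prob 0 ≤ y.prob 0)
  | n + 3, x, y =>
      ∀ (i : Fin (n + 3)) (hx : x ≠ pureState i) (hy : y ≠ pureState i),
        BayesLE (n + 2) (bayesProj i x hx) (bayesProj i y hy)

instance (n : ℕ) : LE (ClassicalState n) := ⟨BayesLE n⟩

/-- The uniform state `⊥ = (1/n, …, 1/n)`. -/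
noncomputable def uniform (n : ℕ) (hn : 2 ≤ n) : ClassicalState n where
  prob := fun _ => 1 / n
  mem := by
    refine ⟨fun _ => by positivity, ?_⟩
    have : (n : ℝ) ≠ 0 := by positivity
    simp [this]

/-- The straight line path `t ↦ (1 - t) a + t b` in `Δⁿ`. -/
noncomputable def linePath {n : ℕ} (a b : ClassicalState n) (t : Set.Icc (0 : ℝ) 1) :
    ClassicalState n where
  prob := (1 - (t : ℝ)) • a.prob + (t : ℝ) • b.prob
  mem := convex_stdSimplex ℝ (Fin n) a.mem b.mem (sub_nonneg.2 t.2.2) t.2.1 (by ring)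

end ClassicalState

/-! ### Quantum states -/

/-- The quantum states `Ωⁿ` on an `n`-dimensional complex Hilbert space `H`: density operators. -/
@[ext]
structure QuantumState (H : Type*) [NormedAddCommGroup H] [InnerProductSpace ℂ H] where
  op : H →ₗ[ℂ] H
  isPositive : op.IsPositive
  trace_eq_one : LinearMap.trace ℂ H op = 1

/-- The observables on an `n`-dimensional complex Hilbert space: self-adjoint operators with
spectrum `{1, …, n}`. -/
structure Observable (H : Type*) [NormedAddCommGroup H] [InnerProductSpace ℂ H] where
  op : H →ₗ[ℂ] H
  isSymmetric : op.IsSymmetric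
  spectrum_eq : spectrum ℂ op = (fun k : ℕ => (k : ℂ)) '' Set.Icc 1 (Module.finrank ℂ H)

section Quantum

variable {H : Type*} [NormedAddCommGroup H] [InnerProductSpace ℂ H]

namespace Observable

/-- The eigenspace of `e` for the eigenvalue `i + 1`, where `i = 0, …, n - 1`. -/
noncomputable def eigenspace (e : Observable H) (i : Fin (Module.finrank ℂ H)) : Submodule ℂ H :=
  Module.End.eigenspace e.op (((i : ℕ) + 1 : ℕ) : ℂ)

theorem orthogonalFamily (e : Observable H) :
    OrthogonalFamily ℂ (fun i => e.eigenspace i) fun i => (e.eigenspace i).subtypeₗᵢ := by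
  have hinj : Function.Injective
      (fun i : Fin (Module.finrank ℂ H) => (((i : ℕ) + 1 : ℕ) : ℂ)) := by
    intro i j h
    have h' : (i : ℕ) + 1 = (j : ℕ) + 1 := Nat.cast_injective h
    exact Fin.ext (by omega)
  exact e.isSymmetric.orthogonalFamily_eigenspaces.comp hinj

variable [FiniteDimensional ℂ H]

/-- The orthogonal projection onto that eigenspace. -/
noncomputable def proj (e : Observable H) (i : Fin (Module.finrank ℂ H)) : H →ₗ[ℂ] H :=
  (e.eigenspace i).starProjection.toLinearMap

theorem iSup_eigenspace (e : Observable H) : ⨆ i, e.eigenspace i = ⊤ := by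
  have h := Submodule.orthogonal_eq_bot_iff.mp
    e.isSymmetric.orthogonalComplement_iSup_eigenspaces_eq_bot
  refine top_unique (h.ge.trans (iSup_le fun μ => ?_))
  by_cases hμ : Module.End.HasEigenvalue e.op μ
  · have hs : μ ∈ spectrum ℂ e.op := hμ.mem_spectrum
    rw [e.spectrum_eq] at hs
    obtain ⟨k, ⟨hk1, hk2⟩, rfl⟩ := hs
    refine le_iSup_of_le (⟨k - 1, by omega⟩ : Fin (Module.finrank ℂ H)) ?_
    simp only [eigenspace, Nat.sub_add_cancel hk1]
    exact le_rfl
  · have : Module.End.eigenspace e.op μ = ⊥ := by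
      by_contra hne
      exact hμ (Module.End.hasEigenvalue_iff.2 hne)
    rw [this]
    exact bot_le

theorem sum_proj (e : Observable H) : ∑ i, e.proj i = LinearMap.id := by
  ext x
  have := e.orthogonalFamily.sum_projection_of_mem_iSup x
    (by rw [e.iSup_eigenspace]; exact Submodule.mem_top)
  simpa [proj, LinearMap.sum_apply] using this

end Observable

namespace QuantumState

variable [FiniteDimensional ℂ H]

/-- The probability `tr(p · ρ)` that a measurement of `e` in the state `ρ` yields the value
`i + 1`. -/
noncomputable def pr (ρ : QuantumState H) (e : Observable H) (i : Fin (Module.finrank ℂ H)) : ℝ :=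
  (LinearMap.trace ℂ H (e.proj i ∘ₗ ρ.op)).re

theorem pr_nonneg (ρ : QuantumState H) (e : Observable H) (i : Fin (Module.finrank ℂ H)) :
    0 ≤ ρ.pr e i := by
  have hpp : e.proj i ∘ₗ e.proj i = e.proj i := by
    ext x
    exact Submodule.starProjection_eq_self_iff.2 (Submodule.starProjection_apply_mem _ _)
  have hp : (e.proj i).IsSymmetric := fun x y =>
    Submodule.inner_starProjection_left_eq_right (e.eigenspace i) x y
  have hpos : (e.proj i ∘ₗ ρ.op ∘ₗ e.proj i).IsPositive := by
    refine ⟨fun x y => ?_, fun x => ?_⟩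
    · simp only [LinearMap.comp_apply]
      rw [hp, ρ.isPositive.isSymmetric, hp]
    · simp only [LinearMap.comp_apply]
      rw [hp]
      exact ρ.isPositive.2 _
  have htr : LinearMap.trace ℂ H (e.proj i ∘ₗ ρ.op) =
      LinearMap.trace ℂ H (e.proj i ∘ₗ ρ.op ∘ₗ e.proj i) := by
    rw [← LinearMap.comp_assoc, LinearMap.trace_comp_comm' (e.proj i) (e.proj i ∘ₗ ρ.op),
      ← LinearMap.comp_assoc, hpp]
  have h0 := hpos.trace_nonneg
  rw [← htr] at h0
  exact (Complex.le_def.1 h0).1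

theorem sum_pr (ρ : QuantumState H) (e : Observable H) : ∑ i, ρ.pr e i = 1 := by
  have h : ∑ i, LinearMap.trace ℂ H (e.proj i ∘ₗ ρ.op) = 1 := by
    have hs : ∑ i, e.proj i ∘ₗ ρ.op = ρ.op := by
      have h1 := congrArg (fun f => f ∘ₗ ρ.op) e.sum_proj
      ext x
      simpa [LinearMap.sum_apply] using LinearMap.congr_fun h1 x
    rw [← map_sum, hs, ρ.trace_eq_one]
  simp only [pr]
  rw [← Complex.re_sum, h, Complex.one_re]

/-- The classical state `spec(ρ|e)` of outcome probabilities of the observable `e` in the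
state `ρ`. -/
noncomputable def spec (ρ : QuantumState H) (e : Observable H) :
    ClassicalState (Module.finrank ℂ H) where
  prob := ρ.pr e
  mem := ⟨ρ.pr_nonneg e, ρ.sum_pr e⟩

/-- The spectral order: `ρ ⊑ σ` iff some observable `e` commutes with both and
`spec(ρ|e) ⊑ spec(σ|e)` in the Bayesian order. -/
instance : LE (QuantumState H) where
  le ρ σ := ∃ e : Observable H,
    ρ.op ∘ₗ e.op = e.op ∘ₗ ρ.op ∧ σ.op ∘ₗ e.op = e.op ∘ₗ σ.op ∧ ρ.spec e ≤ σ.spec e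

/-- The completely mixed state `⊥ = I / n`. -/
noncomputable def uniform (H : Type*) [NormedAddCommGroup H] [InnerProductSpace ℂ H]
    [FiniteDimensional ℂ H] (hn : 2 ≤ Module.finrank ℂ H) : QuantumState H where
  op := (1 / (Module.finrank ℂ H : ℂ)) • LinearMap.id
  isPositive := LinearMap.isPositive_id.smul_of_nonneg (by
    have h : (0 : ℝ) ≤ 1 / (Module.finrank ℂ H : ℝ) := by positivity
    have h' := Complex.zero_le_real.2 h
    push_cast at h'
    exact h')
  trace_eq_one := by
    have : (Module.finrank ℂ H : ℂ) ≠ 0 := by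
      exact_mod_cast (show Module.finrank ℂ H ≠ 0 by omega)
    simp [this]

/-- The straight line path `t ↦ (1 - t) a + t b` in `Ωⁿ`. -/
noncomputable def linePath (a b : QuantumState H) (t : Set.Icc (0 : ℝ) 1) : QuantumState H where
  op := ((1 - (t : ℝ) : ℝ) : ℂ) • a.op + ((t : ℝ) : ℂ) • b.op
  isPositive :=
    (a.isPositive.smul_of_nonneg (Complex.zero_le_real.2 (sub_nonneg.2 t.2.2))).add
      (b.isPositive.smul_of_nonneg (Complex.zero_le_real.2 t.2.1))
  trace_eq_one := by simp [a.trace_eq_one, b.trace_eq_one]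

end QuantumState

end Quantum

/-!
Both orders are closed partial orders on compact spaces, and the straight lines from `⊥` are
continuous monotone paths. In a compact space with a closed partial order, a directed set has a
supremum, and this lies in the closure of the set (`exists_isLUB_mem_closure`). So a continuous
monotone path is Scott continuous, and `y` approximates `x` as soon as `y` lies below all the points
in a neighbourhood of `x` that are themselves below `x`. If the points `p x t`, `t < 1`, have this
property, they approximate `x`; they form a directed set with supremum `x`, every approximation of
`x` is below one of them, and exactness follows (`isExactDcpo_of_paths`).

For classical states, the recursion unfolds to a condition on odds (`ClassicalState.le_iff`):
`x ⊑ y` iff `xᵢ yⱼ ≤ xⱼ yᵢ` whenever `xⱼ < xᵢ`. Closedness and the order axioms are read off from it.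
Mixing `x` with the uniform state makes the odds strictly less extreme, which leaves room for a
perturbation of `x` and gives the neighbourhood property (`ClassicalState.exists_linePath_le`).

For quantum states, `ρ ⊑ σ` iff some common orthonormal eigenbasis gives eigenvalue vectors
`x ⊑ y` (`QuantumState.le_iff_exists_isDiagIn`), and then every common eigenbasis does
(`QuantumState.IsDiagIn.le_of_le`). Orthonormal frames form a compact set, so the states and the
graph of the order are compact, being continuous images of classical data and frames. Transitivity
needs that `ρ ⊑ σ ⊑ τ` makes `ρ` commute with `τ` (`QuantumState.commute_of_le_of_le`), after which
all three are diagonal in one basis. The neighbourhood property transfers because the classical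
bound depends only on the set of eigenvalues.
-/

open Set Filter Topology

/-! ### Compact spaces with a closed partial order -/

section Compact

variable {D : Type*} [LE D] [TopologicalSpace D]

/-- The supremum is a cluster point of the tails of `S`: closed upper sets make it an upper bound, and
closed lower sets make it the least one. -/
theorem exists_isLUB_mem_closure [CompactSpace D] (hpo : IsPartialOrder D (· ≤ ·))
    (hIci : ∀ a : D, IsClosed {b | a ≤ b}) (hIic : ∀ a : D, IsClosed {b | b ≤ a})
    {S : Set D} (hS : IsDirectedSet S) : ∃ a ∈ closure S, IsLUB S a := by
  have : Nonempty S := hS.1.to_subtype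
  have hne : (⋂ s : S, closure (S ∩ {b | s.1 ≤ b})).Nonempty := by
    refine IsCompact.nonempty_iInter_of_directed_nonempty_isCompact_isClosed _ ?_ ?_
      (fun s => isClosed_closure.isCompact) fun s => isClosed_closure
    · rintro ⟨a, ha⟩ ⟨b, hb⟩
      obtain ⟨c, hc, hac, hbc⟩ := hS.2 a ha b hb
      exact ⟨⟨c, hc⟩, closure_mono fun d hd => ⟨hd.1, hpo.trans _ _ _ hac hd.2⟩,
        closure_mono fun d hd => ⟨hd.1, hpo.trans _ _ _ hbc hd.2⟩⟩
    · rintro ⟨a, ha⟩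
      exact ⟨a, subset_closure ⟨ha, hpo.refl a⟩⟩
  obtain ⟨a, ha⟩ := hne
  rw [mem_iInter] at ha
  have haS : a ∈ closure S := by
    obtain ⟨s, hs⟩ := hS.1
    exact closure_mono inter_subset_left (ha ⟨s, hs⟩)
  refine ⟨a, haS, fun s hs => ?_, fun u hu => ?_⟩
  · exact closure_minimal (fun b hb => hb.2) (hIci s) (ha ⟨s, hs⟩)
  · exact closure_minimal (fun b hb => hu hb) (hIic u) haS

/-- The supremum of a directed set is a limit point of it, by uniqueness of suprema. -/
theorem IsLUB.mem_closure_of_isDirectedSet [CompactSpace D] (hpo : IsPartialOrder D (· ≤ ·))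
    (hIci : ∀ a : D, IsClosed {b | a ≤ b}) (hIic : ∀ a : D, IsClosed {b | b ≤ a})
    {S : Set D} (hS : IsDirectedSet S) {a : D} (ha : IsLUB S a) : a ∈ closure S := by
  obtain ⟨b, hb, hbS⟩ := exists_isLUB_mem_closure hpo hIci hIic hS
  rwa [hpo.antisymm a b (ha.2 hbS.1) (hbS.2 ha.1)]

/-- A monotone continuous path into a space with closed principal ideals is Scott continuous. -/
theorem isScottContinuous_of_continuous (hIic : ∀ a : D, IsClosed {b | b ≤ a})
    {p : Icc (0 : ℝ) 1 → D} (hp : Continuous p) (hmono : ∀ s t, s ≤ t → p s ≤ p t) :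
    IsScottContinuous p := by
  refine ⟨hmono, fun S a hS ha => ⟨?_, fun u hu => ?_⟩⟩
  · rintro _ ⟨s, hs, rfl⟩
    exact hmono _ _ (ha.1 hs)
  · have hsub : S ⊆ p ⁻¹' {b | b ≤ u} := fun s hs => hu ⟨s, hs, rfl⟩
    exact closure_minimal hsub ((hIic u).preimage hp) (ha.mem_closure hS.1)

/-- If each `x` is the endpoint of a monotone path whose earlier points lie below everything near
`x` and below `x`, then those earlier points approximate `x`, and the order is exact. -/
theorem isExactDcpo_of_paths [CompactSpace D] (hpo : IsPartialOrder D (· ≤ ·))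
    (hcl : IsClosed {q : D × D | q.1 ≤ q.2})
    (p : D → Icc (0 : ℝ) 1 → D) (hp : ∀ x, Continuous (p x))
    (hmono : ∀ x s t, s ≤ t → p x s ≤ p x t) (hone : ∀ x, p x 1 = x)
    (hnhds : ∀ x, ∀ t : Icc (0 : ℝ) 1, (t : ℝ) < 1 → ∀ᶠ s in 𝓝 x, s ≤ x → p x t ≤ s) :
    IsExactDcpo D ∧ ∀ x, IsScottContinuous (p x) ∧
      ∀ t : Icc (0 : ℝ) 1, (t : ℝ) < 1 → Approximates (p x t) x := by
  have hIci : ∀ a : D, IsClosed {b | a ≤ b} := fun a => hcl.preimage (.prodMk_right a)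
  have hIic : ∀ a : D, IsClosed {b | b ≤ a} := fun a => hcl.preimage (.prodMk_left a)
  have happ : ∀ x, ∀ t : Icc (0 : ℝ) 1, (t : ℝ) < 1 → Approximates (p x t) x := by
    intro x t ht S hS hx
    obtain ⟨s, hs, hsS⟩ := mem_closure_iff_nhds.1
      (hx.mem_closure_of_isDirectedSet hpo hIci hIic hS) _ (hnhds x t ht)
    exact ⟨s, hsS, hs (hx.1 hsS)⟩
  -- The times `t < 1` are directed with supremum `1`, so that the half-open path is a directed set
  -- with supremum `x`.
  have hT : IsDirectedSet {t : Icc (0 : ℝ) 1 | (t : ℝ) < 1} := by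
    refine ⟨⟨0, by simp⟩, fun a ha b hb => ⟨max a b, ?_, le_max_left a b, le_max_right a b⟩⟩
    rcases max_choice a b with h | h <;> rw [h] <;> assumption
  have hT1 : IsLUB {t : Icc (0 : ℝ) 1 | (t : ℝ) < 1} 1 := by
    refine ⟨fun t _ => t.2.2, fun u hu => ?_⟩
    by_contra h
    have hu1 : (u : ℝ) < 1 := lt_of_not_ge h
    have := hu (a := ⟨((u : ℝ) + 1) / 2, by have := u.2.1; constructor <;> linarith⟩)
      (by change ((u : ℝ) + 1) / 2 < 1; linarith)
    have : ((u : ℝ) + 1) / 2 ≤ u := this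
    linarith
  have hscott := fun x => isScottContinuous_of_continuous hIic (hp x) (hmono x)
  have hlub : ∀ x, IsLUB (p x '' {t : Icc (0 : ℝ) 1 | (t : ℝ) < 1}) x := fun x => by
    simpa only [hone] using (hscott x).2 _ _ hT hT1
  have hdir : ∀ x, IsDirectedSet (p x '' {t : Icc (0 : ℝ) 1 | (t : ℝ) < 1}) := by
    refine fun x => ⟨hT.1.image _, ?_⟩
    rintro _ ⟨a, ha, rfl⟩ _ ⟨b, hb, rfl⟩
    obtain ⟨c, hc, hac, hbc⟩ := hT.2 a ha b hb
    exact ⟨_, ⟨c, hc, rfl⟩, hmono x _ _ hac, hmono x _ _ hbc⟩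
  have hle : ∀ x y : D, Approximates y x → y ≤ x := by
    intro x y h
    obtain ⟨_, ⟨t, _, rfl⟩, hy⟩ := h _ (hdir x) (hlub x)
    exact hpo.trans _ _ _ hy (by simpa only [hone] using hmono x t 1 t.2.2)
  refine ⟨⟨⟨hpo, fun S hS => ?_⟩, fun x => ⟨?_, ?_⟩, fun x => ⟨fun y hy => hle x y hy, ?_⟩⟩,
    fun x => ⟨hscott x, happ x⟩⟩
  · obtain ⟨a, -, ha⟩ := exists_isLUB_mem_closure hpo hIci hIic hS
    exact ⟨a, ha⟩
  · exact ⟨_, happ x 0 (by simp)⟩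
  · intro y hy z hz
    obtain ⟨_, ⟨a, ha, rfl⟩, hya⟩ := hy _ (hdir x) (hlub x)
    obtain ⟨_, ⟨b, hb, rfl⟩, hzb⟩ := hz _ (hdir x) (hlub x)
    obtain ⟨c, hc, hac, hbc⟩ := hT.2 a ha b hb
    exact ⟨p x c, happ x c hc, hpo.trans _ _ _ hya (hmono x _ _ hac),
      hpo.trans _ _ _ hzb (hmono x _ _ hbc)⟩
  · refine fun u hu => (hlub x).2 ?_
    rintro _ ⟨t, ht, rfl⟩
    exact hu (happ x t ht)

end Compact

/-! ### The Bayesian order -/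

namespace ClassicalState

variable {n : ℕ}

/-- The Bayesian order without recursion: whenever `x` ranks `i` strictly above `j`, the odds of `i`
against `j` in `y` are at least those in `x`. -/
theorem le_iff (hn : 2 ≤ n) {x y : ClassicalState n} :
    x ≤ y ↔ ∀ i j, x.prob j < x.prob i → x.prob i * y.prob j ≤ x.prob j * y.prob i := by
  change BayesLE n x y ↔ _
  induction n, hn using Nat.le_induction with
  | base =>
    have hx := x.mem.2
    have hy := y.mem.2
    rw [Fin.sum_univ_two] at hx hy
    have hx1 : x.prob 1 = 1 - x.prob 0 := by linarith
    have hy1 : y.prob 1 = 1 - y.prob 0 := by linarith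
    simp only [BayesLE, Fin.forall_fin_two, hx1, hy1, lt_irrefl, false_imp_iff, true_and, and_true]
    constructor
    · rintro (⟨h1, h2⟩ | ⟨h1, h2⟩) <;> constructor <;> intro h <;> nlinarith
    · rintro ⟨h1, h2⟩
      rcases lt_trichotomy (x.prob 0) (1 / 2) with h | h | h
      · exact Or.inl ⟨by linarith [h2 (by linarith)], h.le⟩
      · rcases le_total (y.prob 0) (x.prob 0) with h' | h'
        · exact Or.inl ⟨h', h.le⟩
        · exact Or.inr ⟨h.ge, h'⟩
      · exact Or.inr ⟨h.le, by linarith [h1 (by linarith)]⟩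
  | succ m hm ih =>
    obtain ⟨k, rfl⟩ := Nat.exists_eq_add_of_le' hm
    simp only [BayesLE]
    -- The condition is homogeneous in `x` and in `y`, so renormalizing does not affect it.
    have hproj : ∀ (l : Fin (k + 3)) (hx : x ≠ pureState l) (hy : y ≠ pureState l),
        BayesLE (k + 2) (bayesProj l x hx) (bayesProj l y hy) ↔
          ∀ i j, x.prob (l.succAbove j) < x.prob (l.succAbove i) →
            x.prob (l.succAbove i) * y.prob (l.succAbove j) ≤
              x.prob (l.succAbove j) * y.prob (l.succAbove i) := by
      intro l hx hy
      have hx1 : 0 < 1 - x.prob l := sub_pos.2 (lt_one_of_ne_pureState hx)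
      have hy1 : 0 < 1 - y.prob l := sub_pos.2 (lt_one_of_ne_pureState hy)
      rw [ih]
      refine forall_congr' fun i => forall_congr' fun j => ?_
      simp only [bayesProj]
      rw [div_lt_div_iff_of_pos_right hx1, div_mul_div_comm, div_mul_div_comm,
        div_le_div_iff_of_pos_right (mul_pos hx1 hy1)]
    constructor
    · intro h i j hij
      -- Since `n ≥ 3`, some third outcome `l` can be projected out.
      have hcard : ({i, j} : Finset (Fin (k + 3))).card <
          (Finset.univ : Finset (Fin (k + 3))).card := by
        have := Finset.card_le_two (a := i) (b := j)
        rw [Finset.card_univ, Fintype.card_fin]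
        omega
      obtain ⟨l, -, hl⟩ := Finset.exists_mem_notMem_of_card_lt_card hcard
      simp only [Finset.mem_insert, Finset.mem_singleton, not_or] at hl
      have hli := hl.1
      have hlj := hl.2
      by_cases hx : x = pureState l
      · simp [hx, pureState, Ne.symm hli, Ne.symm hlj] at hij
      by_cases hy : y = pureState l
      · simp [hy, pureState, Ne.symm hli, Ne.symm hlj]
      obtain ⟨i', rfl⟩ := Fin.exists_succAbove_eq (Ne.symm hli)
      obtain ⟨j', rfl⟩ := Fin.exists_succAbove_eq (Ne.symm hlj)
      exact (hproj l hx hy).1 (h l hx hy) i' j' hij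
    · intro h l hx hy
      exact (hproj l hx hy).2 fun i j hij => h _ _ hij

theorem exists_pos (x : ClassicalState n) : ∃ i, 0 < x.prob i := by
  by_contra! h
  have := Finset.sum_nonpos fun i (_ : i ∈ Finset.univ) => h i
  linarith [x.mem.2]

/-- Passing to a larger state only enlarges the set of impossible outcomes. -/
theorem prob_eq_zero_of_le (hn : 2 ≤ n) {x y : ClassicalState n} (h : x ≤ y) {i : Fin n}
    (hi : x.prob i = 0) : y.prob i = 0 := by
  obtain ⟨k, hk⟩ := x.exists_pos
  have := (le_iff hn).1 h k i (by rwa [hi])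
  rw [hi, zero_mul] at this
  have := y.mem.1 i
  nlinarith

protected theorem le_trans (hn : 2 ≤ n) {x y z : ClassicalState n} (hxy : x ≤ y) (hyz : y ≤ z) :
    x ≤ z := by
  rw [le_iff hn]
  intro i j hij
  have h1 := (le_iff hn).1 hxy i j hij
  have hxi : 0 < x.prob i := (x.mem.1 j).trans_lt hij
  have hyi := y.mem.1 i
  have hyj := y.mem.1 j
  have hzi := z.mem.1 i
  have hzj := z.mem.1 j
  rcases lt_or_ge (y.prob j) (y.prob i) with h | h
  · have h2 := (le_iff hn).1 hyz i j h
    have hyi' : 0 < y.prob i := hyj.trans_lt h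
    refine le_of_mul_le_mul_left ?_ hyi'
    calc y.prob i * (x.prob i * z.prob j) = x.prob i * (y.prob i * z.prob j) := by ring
      _ ≤ x.prob i * (y.prob j * z.prob i) := by gcongr
      _ = (x.prob i * y.prob j) * z.prob i := by ring
      _ ≤ (x.prob j * y.prob i) * z.prob i := by gcongr
      _ = y.prob i * (x.prob j * z.prob i) := by ring
  · have hy0 : y.prob j = 0 := by
      by_contra hne
      have : 0 < y.prob j := lt_of_le_of_ne hyj (Ne.symm hne)
      nlinarith [x.mem.1 j]
    rw [prob_eq_zero_of_le hn hyz hy0, mul_zero]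
    exact mul_nonneg (x.mem.1 j) hzi

protected theorem le_antisymm (hn : 2 ≤ n) {x y : ClassicalState n} (hxy : x ≤ y) (hyx : y ≤ x) :
    x = y := by
  rw [le_iff hn] at hxy hyx
  -- Equal odds for each pair of outcomes make `x` and `y` proportional.
  have key : ∀ i j, x.prob j < x.prob i → x.prob i * y.prob j = x.prob j * y.prob i := by
    intro i j hij
    have h := hxy i j hij
    have hyi := y.mem.1 i
    have hyj := y.mem.1 j
    rcases lt_or_ge (y.prob j) (y.prob i) with h' | h'
    · linarith [hyx i j h']
    · nlinarith [x.mem.1 j]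
  have key' : ∀ i j, x.prob i * y.prob j = x.prob j * y.prob i := by
    intro i j
    rcases lt_trichotomy (x.prob j) (x.prob i) with h | h | h
    · exact key i j h
    · have hx := x.mem.1 i
      rcases lt_trichotomy (y.prob j) (y.prob i) with h' | h' | h'
      · have := hyx i j h'
        rw [h] at *
        nlinarith
      · rw [h, h']
      · have := hyx j i h'
        rw [h] at *
        nlinarith
    · exact (key j i h).symm
  ext i
  have : ∑ j, x.prob i * y.prob j = ∑ j, x.prob j * y.prob i :=
    Finset.sum_congr rfl fun j _ => key' i j
  rw [← Finset.mul_sum, ← Finset.sum_mul, x.mem.2, y.mem.2] at this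
  linarith

theorem isPartialOrder (hn : 2 ≤ n) : IsPartialOrder (ClassicalState n) (· ≤ ·) where
  refl _ := (le_iff hn).2 fun _ _ _ => (mul_comm _ _).le
  trans _ _ _ := ClassicalState.le_trans hn
  antisymm _ _ := ClassicalState.le_antisymm hn

theorem uniform_le (hn : 2 ≤ n) (x : ClassicalState n) : uniform n hn ≤ x :=
  (le_iff hn).2 fun _ _ h => absurd h (lt_irrefl _)

theorem linePath_mono (hn : 2 ≤ n) (x : ClassicalState n) {s t : Icc (0 : ℝ) 1} (hst : s ≤ t) :
    linePath (uniform n hn) x s ≤ linePath (uniform n hn) x t := by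
  have hst' : (s : ℝ) ≤ t := hst
  have hs := s.2.1
  have hn0 : (0 : ℝ) < 1 / n := by positivity
  refine (le_iff hn).2 fun i j h => ?_
  simp only [linePath, uniform, Pi.add_apply, Pi.smul_apply, smul_eq_mul] at h ⊢
  have hij : x.prob j ≤ x.prob i := by
    by_contra! h'
    nlinarith
  have := mul_nonneg (mul_nonneg (sub_nonneg.2 hst') hn0.le) (sub_nonneg.2 hij)
  nlinarith

/-- Mixing the odds `a : b` with equal weights `c > 0` lowers them to `c + t a : c + t b`, which leaves
room for a perturbation of `a` and `b` by `ε`. -/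
theorem line_mul_le {c t a b a' b' ε : ℝ} (hc0 : 0 < c) (hc1 : c ≤ 1) (ht0 : 0 ≤ t) (ht1 : t ≤ 1)
    (hb0 : 0 ≤ b) (hba : b < a) (ha1 : a ≤ 1) (hε : 4 * ε ≤ c * (a - b))
    (ha' : |a' - a| ≤ ε) (hb' : |b' - b| ≤ ε) :
    (c + t * a) * b' ≤ (c + t * b) * a' := by
  have hε0 : 0 ≤ ε := (abs_nonneg _).trans ha'
  rw [abs_le] at ha' hb'
  have hta : t * a ≤ 1 := mul_le_one₀ ht1 (by linarith) ha1
  have htb : t * b ≤ 1 := mul_le_one₀ ht1 hb0 (by linarith)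
  have hta0 : 0 ≤ t * a := mul_nonneg ht0 (by linarith)
  have htb0 : 0 ≤ t * b := mul_nonneg ht0 hb0
  calc (c + t * a) * b' ≤ (c + t * a) * (b + ε) := by gcongr; linarith
    _ ≤ (c + t * b) * (a - ε) := by nlinarith
    _ ≤ (c + t * b) * a' := by gcongr; linarith

/-- All states close to `x` lie above the time `t < 1` point of the line from the uniform state to
`x`. The radius depends only on the set of values of `x`, so that it serves also for the
rearrangements `x'` of `x`. -/
theorem exists_linePath_le (hn : 2 ≤ n) (x : ClassicalState n) {t : Icc (0 : ℝ) 1}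
    (ht : (t : ℝ) < 1) : ∃ ε > 0, ∀ x' y : ClassicalState n, range x'.prob ⊆ range x.prob →
      (∀ i, |y.prob i - x'.prob i| ≤ ε) → linePath (uniform n hn) x' t ≤ y := by
  set c : ℝ := (1 - t) * (1 / n) with hc
  have hn0 : (0 : ℝ) < 1 / n := by positivity
  have hn1 : (1 : ℝ) / n ≤ 1 := by
    rw [div_le_one (by positivity)]
    exact_mod_cast (by omega : 1 ≤ n)
  have hc0 : 0 < c := mul_pos (sub_pos.2 ht) hn0
  have hc1 : c ≤ 1 := mul_le_one₀ (by linarith [t.2.1]) hn0.le hn1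
  have hev : ∀ᶠ ε in 𝓝[>] (0 : ℝ), ∀ i j, x.prob j < x.prob i →
      4 * ε ≤ c * (x.prob i - x.prob j) := by
    refine eventually_all.2 fun i => eventually_all.2 fun j => ?_
    by_cases hij : x.prob j < x.prob i
    · have hpos : 4 * (0 : ℝ) < c * (x.prob i - x.prob j) := by
        rw [mul_zero]
        exact mul_pos hc0 (sub_pos.2 hij)
      have hcont : ContinuousAt (fun ε : ℝ => 4 * ε) 0 := by fun_prop
      exact nhdsWithin_le_nhds ((hcont.eventually_lt_const hpos).mono fun ε h _ => h.le)
    · exact Eventually.of_forall fun ε h => absurd h hij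
  obtain ⟨ε, hε, hε0⟩ := (hev.and self_mem_nhdsWithin).exists
  refine ⟨ε, hε0, fun x' y hx' hy => (le_iff hn).2 fun i j h => ?_⟩
  simp only [linePath, uniform, Pi.add_apply, Pi.smul_apply, smul_eq_mul, ← hc] at h ⊢
  obtain ⟨k, hk⟩ := hx' ⟨i, rfl⟩
  obtain ⟨l, hl⟩ := hx' ⟨j, rfl⟩
  have hij : x'.prob j < x'.prob i := by
    by_contra! h'
    nlinarith [t.2.1]
  refine line_mul_le hc0 hc1 t.2.1 t.2.2 (x'.mem.1 j) hij (x'.le_one i) ?_ (hy i) (hy j)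
  rw [← hk, ← hl] at hij ⊢
  exact hε k l hij

/-- The Euclidean topology. -/
instance : TopologicalSpace (ClassicalState n) := .induced prob inferInstance

theorem isInducing_prob : IsInducing (prob : ClassicalState n → Fin n → ℝ) := ⟨rfl⟩

theorem continuous_prob : Continuous (prob : ClassicalState n → Fin n → ℝ) :=
  isInducing_prob.continuous

theorem range_prob : range (prob : ClassicalState n → Fin n → ℝ) = stdSimplex ℝ (Fin n) :=
  Subset.antisymm (range_subset_iff.2 fun x => x.mem) fun p hp => ⟨⟨p, hp⟩, rfl⟩

instance : CompactSpace (ClassicalState n) := by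
  rw [← isCompact_univ_iff, isInducing_prob.isCompact_iff, image_univ, range_prob]
  exact isCompact_stdSimplex ℝ (Fin n)

theorem isClosed_setOf_le (hn : 2 ≤ n) :
    IsClosed {q : ClassicalState n × ClassicalState n | q.1 ≤ q.2} := by
  have h1 : ∀ i, Continuous fun q : ClassicalState n × ClassicalState n => q.1.prob i := fun i =>
    (continuous_apply i).comp (continuous_prob.comp continuous_fst)
  have h2 : ∀ i, Continuous fun q : ClassicalState n × ClassicalState n => q.2.prob i := fun i =>
    (continuous_apply i).comp (continuous_prob.comp continuous_snd)
  simp only [le_iff hn, Set.ofPred_forall, imp_iff_not_or, not_lt]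
  exact isClosed_iInter fun i => isClosed_iInter fun j =>
    (isClosed_le (h1 i) (h1 j)).union
      (isClosed_le ((h1 i).mul (h2 j)) ((h1 j).mul (h2 i)))

theorem linePath_one (a b : ClassicalState n) : linePath a b 1 = b := by
  ext i
  simp [linePath]

theorem continuous_linePath (a b : ClassicalState n) : Continuous (linePath a b) := by
  rw [isInducing_prob.continuous_iff]
  change Continuous fun t : Icc (0 : ℝ) 1 => (1 - (t : ℝ)) • a.prob + (t : ℝ) • b.prob
  fun_prop

theorem eventually_linePath_le (hn : 2 ≤ n) (x : ClassicalState n) {t : Icc (0 : ℝ) 1}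
    (ht : (t : ℝ) < 1) : ∀ᶠ y in 𝓝 x, linePath (uniform n hn) x t ≤ y := by
  obtain ⟨ε, hε, h⟩ := exists_linePath_le hn x ht
  have hy : ∀ᶠ y in 𝓝 x, ∀ i, |y.prob i - x.prob i| < ε := by
    refine eventually_all.2 fun i => ?_
    have hcont : ContinuousAt (fun y : ClassicalState n => |y.prob i - x.prob i|) x :=
      (((continuous_apply i).comp continuous_prob).sub continuous_const).abs.continuousAt
    exact hcont.eventually_lt_const (by simpa using hε)
  exact hy.mono fun y hy => h x y subset_rfl fun i => (hy i).le

end ClassicalState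

/-! ### Operators diagonal in an orthonormal basis -/

section Diagonal

variable {H : Type*} [NormedAddCommGroup H] [InnerProductSpace ℂ H]

/-- The operator `∑ xᵢ |vᵢ⟩⟨vᵢ|`; for an orthonormal basis `v` it has the eigenvectors `vᵢ` with
eigenvalues `xᵢ`. -/
noncomputable def diagOp {ι : Type*} [Fintype ι] (v : ι → H) (x : ι → ℝ) : H →L[ℂ] H :=
  ∑ i, (x i : ℂ) • InnerProductSpace.rankOne ℂ (v i) (v i)

variable {ι : Type*} [Fintype ι]

theorem diagOp_apply_self (v : OrthonormalBasis ι ℂ H) (x : ι → ℝ) (i : ι) :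
    diagOp v x (v i) = (x i : ℂ) • v i := by
  classical
  simp [diagOp, v.inner_eq_ite]

theorem isPositive_diagOp (v : ι → H) {x : ι → ℝ} (hx : ∀ i, 0 ≤ x i) :
    (diagOp v x : H →ₗ[ℂ] H).IsPositive := by
  have h : (diagOp v x : H →ₗ[ℂ] H) =
      ∑ i, (x i : ℂ) • (InnerProductSpace.rankOne ℂ (v i) (v i) : H →ₗ[ℂ] H) := by
    ext u
    simp [diagOp, LinearMap.sum_apply]
  rw [h]
  exact LinearMap.isPositive_sum _ fun i _ =>
    (InnerProductSpace.isPositive_rankOne_self (v i)).toLinearMap.smul_of_nonneg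
      (Complex.zero_le_real.2 (hx i))

theorem continuous_diagOp : Continuous fun p : (ι → H) × (ι → ℝ) => diagOp p.1 p.2 := by
  unfold diagOp
  have h : ∀ i : ι, Continuous fun p : (ι → H) × (ι → ℝ) =>
      InnerProductSpace.rankOne ℂ (p.1 i) (p.1 i) := by
    intro i
    have hi : Continuous fun p : (ι → H) × (ι → ℝ) => p.1 i := by fun_prop
    exact (((ContinuousLinearMap.smulRightL ℂ H H).continuous.comp
      ((innerSL ℂ).continuous.comp hi)).clm_apply hi :)
  fun_prop

theorem inner_basis_apply (v : OrthonormalBasis ι ℂ H) {T : H →ₗ[ℂ] H} {c : ι → ℂ}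
    (h : ∀ i, T (v i) = c i • v i) (i : ι) (u : H) :
    inner ℂ (v i) (T u) = c i * inner ℂ (v i) u := by
  classical
  conv_lhs => rw [← v.sum_repr' u]
  simp [h, v.inner_eq_ite, mul_comm]

/-- An eigenvector overlaps only those basis vectors that share its eigenvalue. -/
theorem eq_of_inner_basis_ne_zero (v : OrthonormalBasis ι ℂ H) {T : H →ₗ[ℂ] H} {c : ι → ℂ}
    (h : ∀ i, T (v i) = c i • v i) {u : H} {μ : ℂ} (hu : T u = μ • u) {i : ι}
    (hi : inner ℂ (v i) u ≠ 0) : c i = μ := by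
  have := inner_basis_apply v h i u
  rw [hu, inner_smul_right] at this
  exact (mul_right_cancel₀ hi this).symm

theorem exists_inner_basis_ne_zero (v : OrthonormalBasis ι ℂ H) {u : H} (hu : u ≠ 0) :
    ∃ i, inner ℂ (v i) u ≠ 0 := by
  by_contra! h
  exact hu (by rw [← v.sum_repr' u]; simp [h])

variable [FiniteDimensional ℂ H]

/-- Commuting symmetric operators have a common orthonormal eigenbasis. -/
theorem exists_orthonormalBasis_of_commute {κ : Type*} {T : κ → H →ₗ[ℂ] H}
    (hT : ∀ k, (T k).IsSymmetric) (hC : Pairwise (Function.onFun Commute T)) :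
    ∃ v : OrthonormalBasis (Fin (Module.finrank ℂ H)) ℂ H,
      ∀ k i, ∃ c : ℂ, T k (v i) = c • v i := by
  classical
  set V : (κ → ℂ) → Submodule ℂ H := fun χ => ⨅ k, Module.End.eigenspace (T k) (χ k)
  have hfam := LinearMap.IsSymmetric.orthogonalFamily_iInf_eigenspaces hT
  -- Only finitely many joint eigenspaces are nonzero.
  have hfin : {χ | V χ ≠ ⊥}.Finite :=
    WellFoundedGT.finite_ne_bot_of_iSupIndep hfam.independent
  have : Fintype {χ // V χ ≠ ⊥} := hfin.fintype
  have hint : DirectSum.IsInternal fun χ : {χ // V χ ≠ ⊥} => V χ := by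
    refine DirectSum.isInternal_ne_bot_iff.2 ?_
    rw [hfam.isInternal_iff, LinearMap.IsSymmetric.iSup_iInf_eq_top_of_commute hT hC,
      Submodule.top_orthogonal_eq_bot]
  have hfam' := hfam.comp (Subtype.val_injective (p := fun χ => V χ ≠ ⊥))
  refine ⟨hint.subordinateOrthonormalBasis rfl hfam', fun k i => ?_⟩
  have hmem := hint.subordinateOrthonormalBasis_subordinate rfl i hfam'
  exact ⟨_, Module.End.mem_eigenspace_iff.1 ((Submodule.mem_iInf _).1 hmem k)⟩

theorem exists_orthonormalBasis_coe_eq {v : Fin (Module.finrank ℂ H) → H} (hv : Orthonormal ℂ v) :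
    ∃ b : OrthonormalBasis (Fin (Module.finrank ℂ H)) ℂ H, ⇑b = v := by
  obtain ⟨b, hb⟩ := Orthonormal.exists_orthonormalBasis_extension_of_card_eq (𝕜 := ℂ)
    (v := v) (s := univ) (by simp) (hv.comp _ Subtype.val_injective)
  exact ⟨b, funext fun i => hb i (mem_univ i)⟩

theorem isCompact_setOf_orthonormal {ι : Type*} : IsCompact {v : ι → H | Orthonormal ℂ v} := by
  classical
  have hK : IsCompact (Set.pi univ fun _ : ι => Metric.closedBall (0 : H) 1) :=
    isCompact_univ_pi fun _ => isCompact_closedBall 0 1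
  refine hK.of_isClosed_subset ?_ fun v hv i _ => ?_
  · simp only [orthonormal_iff_ite, Set.ofPred_forall]
    exact isClosed_iInter fun i => isClosed_iInter fun j =>
      isClosed_eq (by fun_prop) continuous_const
  · simpa using (hv.1 i).le

end Diagonal

/-! ### The spectral order in terms of common eigenbases -/

section Quantum

variable {H : Type*} [NormedAddCommGroup H] [InnerProductSpace ℂ H]

namespace Observable

theorem eq_inner_smul_of_mem_eigenspace (e : Observable H)
    {v : OrthonormalBasis (Fin (Module.finrank ℂ H)) ℂ H} (hv : ∀ i, v i ∈ e.eigenspace i)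
    {i : Fin (Module.finrank ℂ H)} {u : H} (hu : u ∈ e.eigenspace i) :
    u = inner ℂ (v i) u • v i := by
  conv_lhs => rw [← v.sum_repr' u]
  refine Finset.sum_eq_single i (fun k _ hk => ?_) (by simp)
  rw [Submodule.isOrtho_iff_inner_eq.1 (e.orthogonalFamily.isOrtho hk) _ (hv k) _ hu, zero_smul]

variable [FiniteDimensional ℂ H]

theorem proj_apply (e : Observable H)
    {v : OrthonormalBasis (Fin (Module.finrank ℂ H)) ℂ H} (hv : ∀ i, v i ∈ e.eigenspace i)
    (i : Fin (Module.finrank ℂ H)) (u : H) : e.proj i u = inner ℂ (v i) u • v i := by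
  refine Submodule.eq_starProjection_of_mem_of_inner_eq_zero
    (Submodule.smul_mem _ _ (hv i)) fun w hw => ?_
  rw [e.eq_inner_smul_of_mem_eigenspace hv hw, inner_smul_right, inner_sub_left, inner_smul_left,
    inner_conj_symm]
  simp

/-- The spectrum of an observable is simple, so that it determines an indexed eigenbasis. -/
theorem exists_orthonormalBasis (e : Observable H) :
    ∃ v : OrthonormalBasis (Fin (Module.finrank ℂ H)) ℂ H, ∀ i, v i ∈ e.eigenspace i := by
  have hex : ∀ i, ∃ w ∈ e.eigenspace i, w ≠ 0 := by
    intro i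
    have hs : (((i : ℕ) + 1 : ℕ) : ℂ) ∈ spectrum ℂ e.op := by
      rw [e.spectrum_eq]
      exact ⟨_, ⟨by omega, by omega⟩, rfl⟩
    obtain ⟨w, hw⟩ := (Module.End.hasEigenvalue_iff_mem_spectrum.2 hs).exists_hasEigenvector
    exact ⟨w, hw.1, hw.2⟩
  choose w hw hw0 using hex
  have hon : Orthonormal ℂ fun i => ((‖w i‖⁻¹ : ℝ) : ℂ) • w i := by
    refine ⟨fun i => ?_, fun i j hij => ?_⟩
    · simp [norm_smul, hw0 i]
    · exact Submodule.isOrtho_iff_inner_eq.1 (e.orthogonalFamily.isOrtho hij) _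
        (Submodule.smul_mem _ _ (hw i)) _ (Submodule.smul_mem _ _ (hw j))
  obtain ⟨v, hv⟩ := exists_orthonormalBasis_coe_eq hon
  refine ⟨v, fun i => ?_⟩
  rw [hv]
  exact Submodule.smul_mem _ _ (hw i)

/-- The observable with eigenvalue `i + 1` at the `i`-th vector of an orthonormal basis. -/
noncomputable def ofBasis (v : OrthonormalBasis (Fin (Module.finrank ℂ H)) ℂ H) :
    Observable H where
  op := diagOp v fun i => (((i : ℕ) + 1 : ℕ) : ℝ)
  isSymmetric := (isPositive_diagOp v fun i => by positivity).isSymmetric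
  spectrum_eq := by
    have hv : ∀ i, (diagOp v fun i => (((i : ℕ) + 1 : ℕ) : ℝ)) (v i) =
        (((i : ℕ) + 1 : ℕ) : ℂ) • v i := fun i => by
      rw [diagOp_apply_self, Complex.ofReal_natCast]
    ext μ
    rw [← Module.End.hasEigenvalue_iff_mem_spectrum]
    constructor
    · intro h
      obtain ⟨u, hu⟩ := h.exists_hasEigenvector
      obtain ⟨i, hi⟩ := exists_inner_basis_ne_zero v hu.2
      exact ⟨(i : ℕ) + 1, ⟨by omega, by omega⟩, eq_of_inner_basis_ne_zero v hv hu.apply_eq_smul hi⟩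
    · rintro ⟨k, ⟨hk1, hk2⟩, rfl⟩
      have hi := hv ⟨k - 1, by omega⟩
      simp only [Nat.sub_add_cancel hk1] at hi
      exact Module.End.hasEigenvalue_of_hasEigenvector
        ⟨Module.End.mem_eigenspace_iff.2 hi, v.orthonormal.ne_zero _⟩

theorem mem_eigenspace_ofBasis (v : OrthonormalBasis (Fin (Module.finrank ℂ H)) ℂ H)
    (i : Fin (Module.finrank ℂ H)) : v i ∈ (ofBasis v).eigenspace i := by
  refine Module.End.mem_eigenspace_iff.2 ?_
  change diagOp v _ (v i) = _
  rw [diagOp_apply_self, Complex.ofReal_natCast]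

end Observable

namespace QuantumState

/-- `ρ` has the orthonormal eigenbasis `v`, with eigenvalues `x`. -/
def IsDiagIn (ρ : QuantumState H) (v : OrthonormalBasis (Fin (Module.finrank ℂ H)) ℂ H)
    (x : ClassicalState (Module.finrank ℂ H)) : Prop :=
  ∀ i, ρ.op (v i) = (x.prob i : ℂ) • v i

/-- The state with eigenbasis `v` and eigenvalues `x`. -/
noncomputable def ofDiag (v : OrthonormalBasis (Fin (Module.finrank ℂ H)) ℂ H)
    (x : ClassicalState (Module.finrank ℂ H)) : QuantumState H where
  op := diagOp v x.prob
  isPositive := isPositive_diagOp v x.mem.1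
  trace_eq_one := by
    rw [LinearMap.trace_eq_sum_inner _ v]
    simp only [ContinuousLinearMap.coe_coe, diagOp_apply_self, inner_smul_right, v.inner_eq_one,
      mul_one]
    exact_mod_cast x.mem.2

variable {ρ σ : QuantumState H} {v w : OrthonormalBasis (Fin (Module.finrank ℂ H)) ℂ H}
  {x y x' y' : ClassicalState (Module.finrank ℂ H)}

theorem isDiagIn_ofDiag (v : OrthonormalBasis (Fin (Module.finrank ℂ H)) ℂ H)
    (x : ClassicalState (Module.finrank ℂ H)) : (ofDiag v x).IsDiagIn v x :=
  diagOp_apply_self v x.prob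

theorem IsDiagIn.unique (hρ : ρ.IsDiagIn v x) (hσ : σ.IsDiagIn v x) : ρ = σ := by
  ext1
  exact v.toBasis.ext fun i => by rw [v.coe_toBasis, hρ i, hσ i]

theorem IsDiagIn.commute (hρ : ρ.IsDiagIn v x) (hσ : σ.IsDiagIn v y) : Commute ρ.op σ.op := by
  refine v.toBasis.ext fun i => ?_
  simp only [Module.End.mul_apply, v.coe_toBasis, hρ i, hσ i, map_smul]
  exact smul_comm _ _ _

/-- The diagonal matrix entries of a state in an orthonormal basis: a probability vector, by
positivity and trace one. -/
noncomputable def diagEntries (ρ : QuantumState H)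
    (v : OrthonormalBasis (Fin (Module.finrank ℂ H)) ℂ H) :
    ClassicalState (Module.finrank ℂ H) where
  prob := fun i => (inner ℂ (v i) (ρ.op (v i))).re
  mem := by
    refine ⟨fun i => ρ.isPositive.re_inner_nonneg_right (v i), ?_⟩
    rw [← Complex.re_sum, ← LinearMap.trace_eq_sum_inner, ρ.trace_eq_one, Complex.one_re]

theorem isDiagIn_diagEntries (h : ∀ i, ∃ c : ℂ, ρ.op (v i) = c • v i) :
    ρ.IsDiagIn v (ρ.diagEntries v) := by
  intro i
  obtain ⟨c, hc⟩ := h i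
  have hev : Module.End.HasEigenvalue ρ.op c := Module.End.hasEigenvalue_of_hasEigenvector
    ⟨Module.End.mem_eigenspace_iff.2 hc, v.orthonormal.ne_zero i⟩
  have hre : ((c.re : ℝ) : ℂ) = c :=
    Complex.conj_eq_iff_re.1 (ρ.isPositive.isSymmetric.conj_eigenvalue_eq_self hev)
  have : (ρ.diagEntries v).prob i = c.re := by
    simp [diagEntries, hc]
  rw [this, hre, hc]

/-- Any other common eigenbasis witnesses the spectral order as well: each of its vectors overlaps a
vector of the given one with the same pair of eigenvalues. -/
theorem IsDiagIn.le_of_le (hn : 2 ≤ Module.finrank ℂ H) (hρ : ρ.IsDiagIn v x) (hσ : σ.IsDiagIn v y)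
    (hxy : x ≤ y) (hρ' : ρ.IsDiagIn w x') (hσ' : σ.IsDiagIn w y') : x' ≤ y' := by
  have key : ∀ i, ∃ k, x.prob k = x'.prob i ∧ y.prob k = y'.prob i := by
    intro i
    obtain ⟨k, hk⟩ := exists_inner_basis_ne_zero v (w.orthonormal.ne_zero i)
    exact ⟨k, Complex.ofReal_injective (eq_of_inner_basis_ne_zero v hρ (hρ' i) hk),
      Complex.ofReal_injective (eq_of_inner_basis_ne_zero v hσ (hσ' i) hk)⟩
  rw [ClassicalState.le_iff hn] at hxy ⊢
  intro i j hij
  obtain ⟨k, hk, hk'⟩ := key i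
  obtain ⟨l, hl, hl'⟩ := key j
  rw [← hk, ← hl] at hij
  rw [← hk, ← hl, ← hk', ← hl']
  exact hxy k l hij

theorem IsDiagIn.linePath (hρ : ρ.IsDiagIn v x) (hσ : σ.IsDiagIn v y) (t : Icc (0 : ℝ) 1) :
    (linePath ρ σ t).IsDiagIn v (ClassicalState.linePath x y t) := by
  intro i
  simp [QuantumState.linePath, ClassicalState.linePath, hρ i, hσ i, add_smul, mul_smul]

theorem linePath_one (ρ σ : QuantumState H) : linePath ρ σ 1 = σ := by
  ext1
  simp [linePath]

variable [FiniteDimensional ℂ H]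

theorem IsDiagIn.toContinuousLinearMap_op (hρ : ρ.IsDiagIn v x) :
    LinearMap.toContinuousLinearMap ρ.op = diagOp v x.prob := by
  rw [hρ.unique (isDiagIn_ofDiag v x)]
  rfl

theorem spec_eq_diagEntries (ρ : QuantumState H) {e : Observable H}
    (hv : ∀ i, v i ∈ e.eigenspace i) : ρ.spec e = ρ.diagEntries v := by
  ext i
  simp only [spec, pr, diagEntries]
  rw [LinearMap.trace_eq_sum_inner _ v]
  simp [e.proj_apply hv, inner_smul_right, v.inner_eq_ite]

theorem exists_isDiagIn_of_commute {κ : Type*} (T : κ → QuantumState H)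
    (hT : Pairwise (Function.onFun Commute fun k => (T k).op)) :
    ∃ v, ∃ x : κ → ClassicalState (Module.finrank ℂ H), ∀ k, (T k).IsDiagIn v (x k) := by
  obtain ⟨v, hv⟩ := exists_orthonormalBasis_of_commute
    (fun k => (T k).isPositive.isSymmetric) hT
  exact ⟨v, fun k => (T k).diagEntries v, fun k => isDiagIn_diagEntries (hv k)⟩

theorem exists_isDiagIn (ρ : QuantumState H) : ∃ v x, ρ.IsDiagIn v x := by
  obtain ⟨v, x, h⟩ := exists_isDiagIn_of_commute (fun _ : Unit => ρ)
    fun i j hij => absurd (Subsingleton.elim i j) hij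
  exact ⟨v, x (), h ()⟩

/-- The spectral order compares two states through a common eigenbasis. -/
theorem le_iff_exists_isDiagIn :
    ρ ≤ σ ↔ ∃ v x y, ρ.IsDiagIn v x ∧ σ.IsDiagIn v y ∧ x ≤ y := by
  constructor
  · rintro ⟨e, hρ, hσ, hle⟩
    obtain ⟨v, hv⟩ := e.exists_orthonormalBasis
    have key : ∀ τ : QuantumState H, τ.op ∘ₗ e.op = e.op ∘ₗ τ.op →
        τ.IsDiagIn v (τ.diagEntries v) := by
      refine fun τ hτ => isDiagIn_diagEntries fun i =>
        ⟨_, e.eq_inner_smul_of_mem_eigenspace hv (Module.End.mem_eigenspace_iff.2 ?_)⟩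
      have h := LinearMap.congr_fun hτ (v i)
      simp only [LinearMap.comp_apply] at h
      rw [← h, Module.End.mem_eigenspace_iff.1 (hv i), map_smul]
    refine ⟨v, _, _, key ρ hρ, key σ hσ, ?_⟩
    rwa [← ρ.spec_eq_diagEntries hv, ← σ.spec_eq_diagEntries hv]
  · rintro ⟨v, x, y, hx, hy, hxy⟩
    have hv := Observable.mem_eigenspace_ofBasis v
    have hcomm : ∀ (τ : QuantumState H) (z), τ.IsDiagIn v z →
        τ.op ∘ₗ (Observable.ofBasis v).op = (Observable.ofBasis v).op ∘ₗ τ.op := by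
      refine fun τ z hz => v.toBasis.ext fun i => ?_
      simp only [LinearMap.comp_apply, v.coe_toBasis, hz i, map_smul,
        Module.End.mem_eigenspace_iff.1 (hv i)]
      exact smul_comm _ _ _
    have hspec : ∀ (τ : QuantumState H) (z), τ.IsDiagIn v z →
        τ.spec (Observable.ofBasis v) = z := by
      intro τ z hz
      rw [τ.spec_eq_diagEntries hv]
      ext i
      simp [diagEntries, hz i]
    refine ⟨.ofBasis v, hcomm ρ x hx, hcomm σ y hy, ?_⟩
    rwa [hspec ρ x hx, hspec σ y hy]

variable {τ : QuantumState H}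

/-- On an eigenspace of `σ` with nonzero eigenvalue, `ρ ⊑ σ` is a scalar; the kernel of `σ` is
invariant under `ρ` and annihilated by `τ ⊒ σ`. Hence `ρ` commutes with `τ`. -/
theorem commute_of_le_of_le (hn : 2 ≤ Module.finrank ℂ H) (h₁ : ρ ≤ σ) (h₂ : σ ≤ τ) :
    Commute ρ.op τ.op := by
  obtain ⟨v, x, y, hρ, hσ, hxy⟩ := le_iff_exists_isDiagIn.1 h₁
  obtain ⟨w, y', z, hσ', hτ, hyz⟩ := le_iff_exists_isDiagIn.1 h₂
  refine w.toBasis.ext fun j => ?_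
  simp only [Module.End.mul_apply, w.coe_toBasis]
  rcases eq_or_ne (y'.prob j) 0 with hj | hj
  · have hz := ClassicalState.prob_eq_zero_of_le hn hyz hj
    have hker : ∀ u, σ.op u = 0 → τ.op u = 0 := by
      intro u hu
      rw [← w.sum_repr' (τ.op u)]
      refine Finset.sum_eq_zero fun k _ => ?_
      rw [inner_basis_apply w hτ k u]
      by_cases hk : inner ℂ (w k) u = 0
      · simp [hk]
      · have h0 := eq_of_inner_basis_ne_zero w hσ' (μ := 0) (by simpa using hu) hk
        have := ClassicalState.prob_eq_zero_of_le hn hyz (Complex.ofReal_eq_zero.1 h0)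
        simp [this]
    have hσw : σ.op (w j) = 0 := by simp [hσ' j, hj]
    rw [hker _ hσw, hker _ ?_, map_zero]
    have hcomm := LinearMap.congr_fun (hρ.commute hσ) (w j)
    simp only [Module.End.mul_apply] at hcomm
    rw [← hcomm, hσw, map_zero]
  · have hpos : 0 < y'.prob j := lt_of_le_of_ne (y'.mem.1 j) hj.symm
    have hy : ∀ k, inner ℂ (v k) (w j) ≠ 0 → y.prob k = y'.prob j := fun k hk =>
      Complex.ofReal_injective (eq_of_inner_basis_ne_zero v hσ (hσ' j) hk)
    have hle : ∀ k l, inner ℂ (v k) (w j) ≠ 0 → inner ℂ (v l) (w j) ≠ 0 →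
        x.prob k ≤ x.prob l := by
      intro k l hk hl
      by_contra! h
      have := (ClassicalState.le_iff hn).1 hxy k l h
      rw [hy k hk, hy l hl] at this
      exact absurd (le_of_mul_le_mul_right this hpos) (not_le.2 h)
    obtain ⟨k, hk⟩ := exists_inner_basis_ne_zero v (w.orthonormal.ne_zero j)
    have hρw : ρ.op (w j) = (x.prob k : ℂ) • w j := by
      rw [← v.sum_repr' (ρ.op (w j))]
      conv_rhs => rw [← v.sum_repr' (w j)]
      rw [Finset.smul_sum]
      refine Finset.sum_congr rfl fun l _ => ?_
      rw [inner_basis_apply v hρ l, smul_smul]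
      by_cases hl : inner ℂ (v l) (w j) = 0
      · simp [hl]
      · rw [le_antisymm (hle k l hk hl) (hle l k hl hk)]
    simp only [hτ j, map_smul, hρw]
    exact smul_comm _ _ _

protected theorem le_trans (hn : 2 ≤ Module.finrank ℂ H) (h₁ : ρ ≤ σ) (h₂ : σ ≤ τ) : ρ ≤ τ := by
  obtain ⟨v, x, y, hρ, hσ, hxy⟩ := le_iff_exists_isDiagIn.1 h₁
  obtain ⟨w, y', z, hσ', hτ, hyz⟩ := le_iff_exists_isDiagIn.1 h₂
  have hρσ := hρ.commute hσ
  have hστ := hσ'.commute hτ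
  have hρτ := commute_of_le_of_le hn h₁ h₂
  obtain ⟨u, p, hp⟩ := exists_isDiagIn_of_commute ![ρ, σ, τ] (by
    intro i j hij
    fin_cases i <;> fin_cases j <;>
      first
      | exact absurd rfl hij
      | exact hρσ
      | exact hρσ.symm
      | exact hστ
      | exact hστ.symm
      | exact hρτ
      | exact hρτ.symm)
  exact le_iff_exists_isDiagIn.2 ⟨u, p 0, p 2, hp 0, hp 2, ClassicalState.le_trans hn
    (hρ.le_of_le hn hσ hxy (hp 0) (hp 1)) (hσ'.le_of_le hn hτ hyz (hp 1) (hp 2))⟩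

theorem isPartialOrder (hn : 2 ≤ Module.finrank ℂ H) :
    IsPartialOrder (QuantumState H) (· ≤ ·) where
  refl ρ := by
    obtain ⟨v, x, h⟩ := ρ.exists_isDiagIn
    exact le_iff_exists_isDiagIn.2 ⟨v, x, x, h, h, (ClassicalState.isPartialOrder hn).refl x⟩
  trans _ _ _ := QuantumState.le_trans hn
  antisymm ρ σ h₁ h₂ := by
    obtain ⟨v, x, y, hρ, hσ, hxy⟩ := le_iff_exists_isDiagIn.1 h₁
    obtain ⟨w, y', x', hσ', hρ', hyx⟩ := le_iff_exists_isDiagIn.1 h₂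
    obtain rfl := ClassicalState.le_antisymm hn hxy (hσ'.le_of_le hn hρ' hyx hσ hρ)
    exact hρ.unique hσ

/-! ### The topology of the quantum states -/

/-- The operator norm topology. -/
noncomputable instance : TopologicalSpace (QuantumState H) :=
  .induced (fun ρ => LinearMap.toContinuousLinearMap ρ.op) inferInstance

theorem isInducing_op :
    IsInducing fun ρ : QuantumState H => LinearMap.toContinuousLinearMap ρ.op := ⟨rfl⟩

theorem range_op : range (fun ρ : QuantumState H => LinearMap.toContinuousLinearMap ρ.op) =
    (fun p : ClassicalState (Module.finrank ℂ H) × (Fin (Module.finrank ℂ H) → H) =>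
      diagOp p.2 p.1.prob) '' (univ ×ˢ {v | Orthonormal ℂ v}) := by
  ext T
  constructor
  · rintro ⟨ρ, rfl⟩
    obtain ⟨v, x, h⟩ := ρ.exists_isDiagIn
    exact ⟨(x, v), ⟨mem_univ _, v.orthonormal⟩, h.toContinuousLinearMap_op.symm⟩
  · rintro ⟨⟨x, v⟩, ⟨-, hv⟩, rfl⟩
    obtain ⟨b, rfl⟩ := exists_orthonormalBasis_coe_eq hv
    exact ⟨ofDiag b x, (isDiagIn_ofDiag b x).toContinuousLinearMap_op⟩

instance : CompactSpace (QuantumState H) := by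
  rw [← isCompact_univ_iff, isInducing_op.isCompact_iff, image_univ, range_op]
  refine (isCompact_univ.prod isCompact_setOf_orthonormal).image ?_
  exact continuous_diagOp.comp
    (continuous_snd.prodMk (ClassicalState.continuous_prob.comp continuous_fst))

/-- The graph of the spectral order is a continuous image of a compact set: pairs of comparable
classical states together with an orthonormal frame. -/
theorem isClosed_setOf_le (hn : 2 ≤ Module.finrank ℂ H) :
    IsClosed {q : QuantumState H × QuantumState H | q.1 ≤ q.2} := by
  have hK : IsCompact ({q : ClassicalState (Module.finrank ℂ H) ×
      ClassicalState (Module.finrank ℂ H) | q.1 ≤ q.2} ×ˢ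
        {v : Fin (Module.finrank ℂ H) → H | Orthonormal ℂ v}) :=
    (ClassicalState.isClosed_setOf_le hn).isCompact.prod isCompact_setOf_orthonormal
  have h1 := continuous_diagOp.comp (continuous_snd.prodMk
    (ClassicalState.continuous_prob.comp (continuous_fst.comp continuous_fst)) :
    Continuous fun p : (ClassicalState (Module.finrank ℂ H) × ClassicalState (Module.finrank ℂ H)) ×
      (Fin (Module.finrank ℂ H) → H) => (p.2, p.1.1.prob))
  have h2 := continuous_diagOp.comp (continuous_snd.prodMk
    (ClassicalState.continuous_prob.comp (continuous_snd.comp continuous_fst)) :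
    Continuous fun p : (ClassicalState (Module.finrank ℂ H) × ClassicalState (Module.finrank ℂ H)) ×
      (Fin (Module.finrank ℂ H) → H) => (p.2, p.1.2.prob))
  have hcl := (hK.image (h1.prodMk h2)).isClosed
  have hcont : Continuous fun q : QuantumState H × QuantumState H =>
      (LinearMap.toContinuousLinearMap q.1.op, LinearMap.toContinuousLinearMap q.2.op) :=
    (isInducing_op.continuous.comp continuous_fst).prodMk
      (isInducing_op.continuous.comp continuous_snd)
  convert hcl.preimage hcont using 1
  ext ⟨ρ, σ⟩
  simp only [mem_ofPred_eq, le_iff_exists_isDiagIn, mem_preimage]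
  constructor
  · rintro ⟨v, x, y, hρ, hσ, hxy⟩
    exact ⟨((x, y), v), ⟨hxy, v.orthonormal⟩, Prod.ext hρ.toContinuousLinearMap_op.symm
      hσ.toContinuousLinearMap_op.symm⟩
  · rintro ⟨⟨⟨x, y⟩, v⟩, ⟨hxy, hv⟩, heq⟩
    obtain ⟨b, rfl⟩ := exists_orthonormalBasis_coe_eq hv
    obtain ⟨hρ, hσ⟩ := Prod.ext_iff.1 heq
    refine ⟨b, x, y, fun i => ?_, fun i => ?_, hxy⟩
    · exact (DFunLike.congr_fun hρ (b i)).symm.trans (diagOp_apply_self b x.prob i)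
    · exact (DFunLike.congr_fun hσ (b i)).symm.trans (diagOp_apply_self b y.prob i)

/-! ### Lines from the completely mixed state -/

theorem isDiagIn_uniform (hn : 2 ≤ Module.finrank ℂ H)
    (v : OrthonormalBasis (Fin (Module.finrank ℂ H)) ℂ H) :
    (uniform H hn).IsDiagIn v (ClassicalState.uniform _ hn) := by
  intro i
  simp [uniform, ClassicalState.uniform]

theorem uniform_le (hn : 2 ≤ Module.finrank ℂ H) (ρ : QuantumState H) : uniform H hn ≤ ρ := by
  obtain ⟨v, x, h⟩ := ρ.exists_isDiagIn
  exact le_iff_exists_isDiagIn.2 ⟨v, _, x, isDiagIn_uniform hn v, h, x.uniform_le hn⟩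

theorem linePath_mono (hn : 2 ≤ Module.finrank ℂ H) (ρ : QuantumState H) {s t : Icc (0 : ℝ) 1}
    (hst : s ≤ t) : linePath (uniform H hn) ρ s ≤ linePath (uniform H hn) ρ t := by
  obtain ⟨v, x, h⟩ := ρ.exists_isDiagIn
  exact le_iff_exists_isDiagIn.2 ⟨v, _, _, (isDiagIn_uniform hn v).linePath h s,
    (isDiagIn_uniform hn v).linePath h t, x.linePath_mono hn hst⟩

theorem continuous_linePath (ρ σ : QuantumState H) : Continuous (linePath ρ σ) := by
  rw [isInducing_op.continuous_iff]
  have h : (fun τ : QuantumState H => LinearMap.toContinuousLinearMap τ.op) ∘ linePath ρ σ =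
      fun t : Icc (0 : ℝ) 1 => ((1 - (t : ℝ) : ℝ) : ℂ) • LinearMap.toContinuousLinearMap ρ.op +
        ((t : ℝ) : ℂ) • LinearMap.toContinuousLinearMap σ.op := by
    funext t
    simp only [Function.comp_apply, linePath, map_add, map_smul]
  rw [h]
  fun_prop

/-- States `σ ⊑ ρ` close to `ρ` are above the time `t < 1` point of the line to `ρ`: in a common
eigenbasis, the eigenvalues of `σ` are close to those of `ρ`, with a bound that does not depend on
the eigenbasis. -/
theorem eventually_linePath_le (hn : 2 ≤ Module.finrank ℂ H) (ρ : QuantumState H)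
    {t : Icc (0 : ℝ) 1} (ht : (t : ℝ) < 1) :
    ∀ᶠ σ in 𝓝 ρ, σ ≤ ρ → linePath (uniform H hn) ρ t ≤ σ := by
  obtain ⟨v, x, hx⟩ := ρ.exists_isDiagIn
  obtain ⟨ε, hε, hle⟩ := x.exists_linePath_le hn ht
  have hcont : ContinuousAt (fun σ : QuantumState H =>
      ‖LinearMap.toContinuousLinearMap σ.op - LinearMap.toContinuousLinearMap ρ.op‖) ρ :=
    (isInducing_op.continuous.sub continuous_const).norm.continuousAt
  have hev := hcont.eventually_lt_const (show _ < ε by simpa using hε)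
  refine hev.mono fun σ hσε hσρ => ?_
  obtain ⟨w, y, x', hy, hx', -⟩ := le_iff_exists_isDiagIn.1 hσρ
  refine le_iff_exists_isDiagIn.2 ⟨w, _, y, (isDiagIn_uniform hn w).linePath hx' t, hy,
    hle x' y ?_ fun i => ?_⟩
  · rintro _ ⟨i, rfl⟩
    obtain ⟨k, hk⟩ := exists_inner_basis_ne_zero v (w.orthonormal.ne_zero i)
    exact ⟨k, Complex.ofReal_injective (eq_of_inner_basis_ne_zero v hx (hx' i) hk)⟩
  · refine le_trans ?_ hσε.le
    have h := (LinearMap.toContinuousLinearMap σ.op -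
      LinearMap.toContinuousLinearMap ρ.op).le_opNorm (w i)
    rw [w.norm_eq_one, mul_one] at h
    refine le_trans (le_of_eq ?_) h
    have hw : (LinearMap.toContinuousLinearMap σ.op - LinearMap.toContinuousLinearMap ρ.op) (w i) =
        ((y.prob i - x'.prob i : ℝ) : ℂ) • w i := by
      simp [hy i, hx' i, sub_smul]
    rw [hw, norm_smul, w.norm_eq_one, mul_one, Complex.norm_real, Real.norm_eq_abs]

end QuantumState

end Quantum

theorem mainTheorem3 :
    (∀ (n : ℕ) (hn : 2 ≤ n),
      IsExactDcpo (ClassicalState n) ∧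
      IsBot (ClassicalState.uniform n hn) ∧
      ∀ x : ClassicalState n,
        IsScottContinuous (ClassicalState.linePath (ClassicalState.uniform n hn) x) ∧
        ∀ t : Set.Icc (0 : ℝ) 1, (t : ℝ) < 1 →
          Approximates (ClassicalState.linePath (ClassicalState.uniform n hn) x t) x) ∧
    (∀ (H : Type*) [NormedAddCommGroup H] [InnerProductSpace ℂ H] [FiniteDimensional ℂ H]
      (hn : 2 ≤ Module.finrank ℂ H),
      IsExactDcpo (QuantumState H) ∧
      IsBot (QuantumState.uniform H hn) ∧
      ∀ ρ : QuantumState H,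
        IsScottContinuous (QuantumState.linePath (QuantumState.uniform H hn) ρ) ∧
        ∀ t : Set.Icc (0 : ℝ) 1, (t : ℝ) < 1 →
          Approximates (QuantumState.linePath (QuantumState.uniform H hn) ρ t) ρ) := by
  refine ⟨fun n hn => ?_, fun H _ _ _ hn => ?_⟩
  · obtain ⟨hexact, hpath⟩ := isExactDcpo_of_paths (ClassicalState.isPartialOrder hn)
      (ClassicalState.isClosed_setOf_le hn) (ClassicalState.linePath (.uniform n hn))
      (ClassicalState.continuous_linePath _) (fun x _ _ => x.linePath_mono hn)
      (ClassicalState.linePath_one _)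
      fun x _ ht => (x.eventually_linePath_le hn ht).mono fun _ h _ => h
    exact ⟨hexact, ClassicalState.uniform_le hn, hpath⟩
  · obtain ⟨hexact, hpath⟩ := isExactDcpo_of_paths (QuantumState.isPartialOrder hn)
      (QuantumState.isClosed_setOf_le hn) (QuantumState.linePath (.uniform H hn))
      (QuantumState.continuous_linePath _) (fun ρ _ _ => ρ.linePath_mono hn)
      (QuantumState.linePath_one _) fun ρ _ ht => ρ.eventually_linePath_le hn ht
    exact ⟨hexact, QuantumState.uniform_le hn, hpath⟩
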